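/- Let $n\ge 2$ and let $H\le \mathrm{SO}(n)$ be a closed subgroup. Let $\mathfrak h\le\mathfrak{so}(n)$ be its Lie algebra, i.e. $\mathfrak h=\{A\in\mathbb R^{n\times n} : \exp(tA)\in H \text{ for all } t\in\mathbb R\}$. For $x\in\mathbb R^n$ put $\operatorname{rank}_x\mathfrak h:=\dim\{Ax : A\in\mathfrak h\}$. Then the natural action of $H$ on the unit sphere $S^{n-1}\subset\mathbb R^n$, by matrix multiplication, is transitive if and only if $\operatorname{rank}_x\mathfrak h=n-1$ for some $x\in S^{n-1}$. -/

import Mathlib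

attribute [local instance] LieRing.ofAssociativeRing

noncomputable section

namespace SphereAction

open Matrix

/-- The special orthogonal group `SO(n)`. -/
abbrev SO (n : ℕ) : Type := Matrix.specialOrthogonalGroup (Fin n) ℝ

/-- The unit sphere `S^{n-1}` in Euclidean space `ℝⁿ`. -/
abbrev Sphere (n : ℕ) : Type := Metric.sphere (0 : EuclideanSpace ℝ (Fin n)) 1

/-- The product `A x` of a matrix and a vector of Euclidean space. -/
def mulVecE {n : ℕ} (A : Matrix (Fin n) (Fin n) ℝ) (x : EuclideanSpace ℝ (Fin n)) :
    EuclideanSpace ℝ (Fin n) :=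
  WithLp.toLp 2 (A *ᵥ x.ofLp)

theorem norm_mulVecE {n : ℕ} (g : SO n) (x : EuclideanSpace ℝ (Fin n)) :
    ‖mulVecE (g : Matrix (Fin n) (Fin n) ℝ) x‖ = ‖x‖ := by
  have hg : (g : Matrix (Fin n) (Fin n) ℝ)ᵀ * (g : Matrix (Fin n) (Fin n) ℝ) = 1 :=
    (Matrix.mem_orthogonalGroup_iff' (Fin n) ℝ).1
      ((Matrix.mem_specialOrthogonalGroup_iff).1 g.2).1
  have key : ∀ v : EuclideanSpace ℝ (Fin n), ‖v‖ ^ 2 = v.ofLp ⬝ᵥ v.ofLp := by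
    intro v
    rw [EuclideanSpace.norm_sq_eq]
    simp [dotProduct, sq]
  have h2 : ‖mulVecE (g : Matrix (Fin n) (Fin n) ℝ) x‖ ^ 2 = ‖x‖ ^ 2 := by
    rw [key, key]
    simp only [mulVecE]
    rw [Matrix.dotProduct_mulVec, Matrix.vecMul_mulVec, hg, Matrix.vecMul_one]
  exact (sq_eq_sq₀ (norm_nonneg _) (norm_nonneg _)).1 h2

/-- The natural action of `SO(n)` on the unit sphere by matrix multiplication. -/
instance sphereAction (n : ℕ) : MulAction (SO n) (Sphere n) where
  smul g x := ⟨mulVecE (g : Matrix (Fin n) (Fin n) ℝ) x.1, by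
    rw [mem_sphere_zero_iff_norm, norm_mulVecE]
    exact mem_sphere_zero_iff_norm.1 x.2⟩
  one_smul x := by
    apply Subtype.ext
    change mulVecE (1 : Matrix (Fin n) (Fin n) ℝ) x.1 = x.1
    simp [mulVecE]
  mul_smul g k x := by
    apply Subtype.ext
    change mulVecE ((g : Matrix (Fin n) (Fin n) ℝ) * (k : Matrix (Fin n) (Fin n) ℝ)) x.1 =
      mulVecE (g : Matrix (Fin n) (Fin n) ℝ) (mulVecE (k : Matrix (Fin n) (Fin n) ℝ) x.1)
    simp [mulVecE]

/-- The Lie algebra `h` is the Lie algebra of the subgroup `H` of `SO(n)`: it consists of exactly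
those matrices `A` whose one-parameter group `exp (t A)`, `t ∈ ℝ`, lies in `H`. -/
def IsLieAlgebraOf {n : ℕ} (h : LieSubalgebra ℝ (Matrix (Fin n) (Fin n) ℝ))
    (H : Subgroup (SO n)) : Prop :=
  ∀ A : Matrix (Fin n) (Fin n) ℝ,
    A ∈ h ↔ ∀ t : ℝ, ∃ g ∈ H, (g : Matrix (Fin n) (Fin n) ℝ) = NormedSpace.exp (t • A)

/-- The evaluation map `A ↦ A x`. -/
def evalAt {n : ℕ} (x : EuclideanSpace ℝ (Fin n)) :
    Matrix (Fin n) (Fin n) ℝ →ₗ[ℝ] EuclideanSpace ℝ (Fin n) where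
  toFun A := mulVecE A x
  map_add' A B := by simp [mulVecE, Matrix.add_mulVec]
  map_smul' c A := by simp [mulVecE, Matrix.smul_mulVec]

/-- The rank of a Lie algebra `h` of matrices at `x`: the dimension of `{A x : A ∈ h}`. -/
def rankAt {n : ℕ} (h : LieSubalgebra ℝ (Matrix (Fin n) (Fin n) ℝ))
    (x : EuclideanSpace ℝ (Fin n)) : ℕ :=
  Module.finrank ℝ (Submodule.map (evalAt x) h.toSubmodule)

end SphereAction

end

/-!
Let `V = ℝⁿ` and let `T x = {A x : A ∈ h}` be the tangent space of the orbit of a unit vector `x`;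
one-parameter groups of isometries have skew generators, so `T x ≤ xᗮ`, and the rank condition says
`T x = xᗮ`.

If `T x = xᗮ`, the inverse function theorem for `(s, A) ↦ s • exp A x` shows that the orbit of `x`
contains a neighbourhood of `x` in the sphere. By homogeneity the orbit is open in the sphere; it is
also compact, and the sphere is connected for `n ≥ 2`.

Conversely, choose a linear section `σ : T x → h` of `A ↦ A x` and write `A = σ (A x) + B`, so that
`B x = 0`. Cartan's argument for closed subgroups shows that near `1` the group consists of the
products `exp (σ (A x)) * exp B`, whose values at `x` are `exp (σ (A x)) x`. Hence the orbit of `x`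
is a countable union of smooth images of `T x` and its Hausdorff dimension is at most `dim (T x)`.
If the orbit is the whole sphere, this dimension is at least `n - 1`, because the sphere projects
onto the unit ball of `xᗮ`.
-/

namespace SphereAction

open Filter Topology NormedSpace Module Metric

section ClosedSubgroup

theorem tendsto_floor_div_norm_zsmul {ι E : Type*} [NormedAddCommGroup E] [NormedSpace ℝ E]
    {l : Filter ι} {c : ι → E} {u : E} (hc : Tendsto c l (𝓝 0)) (hne : ∀ i, c i ≠ 0)
    (hu : Tendsto (fun i => ‖c i‖⁻¹ • c i) l (𝓝 u)) (t : ℝ) :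
    Tendsto (fun i => ⌊t / ‖c i‖⌋ • c i) l (𝓝 (t • u)) := by
  have hpos : ∀ i, 0 < ‖c i‖ := fun i => norm_pos_iff.2 (hne i)
  have hcoef : Tendsto (fun i => (⌊t / ‖c i‖⌋ : ℝ) * ‖c i‖) l (𝓝 t) := by
    have hlower : Tendsto (fun i => t - ‖c i‖) l (𝓝 t) := by
      simpa using tendsto_const_nhds.sub hc.norm
    refine tendsto_of_tendsto_of_tendsto_of_le_of_le hlower tendsto_const_nhds
      (fun i => ?_) (fun i => ?_)
    · calc t - ‖c i‖ = (t / ‖c i‖ - 1) * ‖c i‖ := by field_simp [(hpos i).ne']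
        _ ≤ ⌊t / ‖c i‖⌋ * ‖c i‖ := by gcongr; exact (Int.sub_one_lt_floor _).le
    · exact (le_div_iff₀ (hpos i)).1 (Int.floor_le _)
  refine (hcoef.smul hu).congr fun i => ?_
  rw [smul_smul, mul_assoc, mul_inv_cancel₀ (hpos i).ne', mul_one, Int.cast_smul_eq_zsmul]

variable {𝔸 : Type*} [NormedRing 𝔸] [NormedAlgebra ℝ 𝔸] {G : Type*} [Group G]

/-- The Lie algebra of the image of a homomorphism `ρ` from a group to an algebra: the subspace `h`
of all `a` whose one-parameter group `exp (t a)` lies in the image. A homomorphism, rather than a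
subgroup of the algebra's units, is used so that abstract groups of matrices fit in directly. That
this set is a subspace is part of the assumption. -/
def IsLieAlgebraOfRange (h : Submodule ℝ 𝔸) (ρ : G →* 𝔸) : Prop :=
  ∀ a : 𝔸, a ∈ h ↔ ∀ t : ℝ, exp (t • a) ∈ Set.range ρ

theorem IsLieAlgebraOfRange.exp_mem_range {h : Submodule ℝ 𝔸} {ρ : G →* 𝔸}
    (hh : IsLieAlgebraOfRange h ρ) {a : 𝔸} (ha : a ∈ h) : exp a ∈ Set.range ρ := by
  simpa using (hh a).1 ha 1

theorem hasStrictFDerivAt_exp_comp_of_map_eq_zero [CompleteSpace 𝔸] {E : Type*}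
    [NormedAddCommGroup E] [NormedSpace ℝ E] (f : E →L[ℝ] 𝔸) {z : E} (hz : f z = 0) :
    HasStrictFDerivAt (fun y => exp (f y)) f z := by
  have hexp : HasStrictFDerivAt (exp : 𝔸 → 𝔸) (1 : 𝔸 →L[ℝ] 𝔸) (f z) :=
    hz ▸ hasStrictFDerivAt_exp_zero
  exact hexp.comp z f.hasStrictFDerivAt

theorem map_exp_mul_exp_mul_exp_nhds_zero [CompleteSpace 𝔸] {E : Type*} [NormedAddCommGroup E]
    [NormedSpace ℝ E] [CompleteSpace E] {f₁ f₂ f₃ : E →L[ℝ] 𝔸} (hf : (f₁ + f₂ + f₃).range = ⊤) :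
    map (fun z => exp (f₁ z) * exp (f₂ z) * exp (f₃ z)) (𝓝 0) = 𝓝 1 := by
  have hexp (f : E →L[ℝ] 𝔸) : HasStrictFDerivAt (fun z => exp (f z)) f 0 :=
    hasStrictFDerivAt_exp_comp_of_map_eq_zero f (map_zero f)
  have hprod : HasStrictFDerivAt (fun z => exp (f₁ z) * exp (f₂ z) * exp (f₃ z))
      (f₁ + f₂ + f₃) 0 := by
    refine (((hexp f₁).mul' (hexp f₂)).mul' (hexp f₃)).congr_fderiv ?_
    ext z
    simp [add_comm, add_left_comm]
  simpa using hprod.map_nhds_eq_of_surj hf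

theorem map_zpow_eq_exp_zsmul [CompleteSpace 𝔸] {ρ : G →* 𝔸} {g : G} {a : 𝔸}
    (hg : ρ g = exp a) (k : ℤ) : ρ (g ^ k) = exp (k • a) := by
  let _ : NormedAlgebra ℚ 𝔸 := NormedAlgebra.restrictScalars ℚ ℝ 𝔸
  have hpow (j : ℕ) : ρ (g ^ j) = exp (j • a) := by rw [map_pow, hg, exp_nsmul]
  obtain ⟨j, rfl | rfl⟩ := k.eq_nat_or_neg
  · simpa using hpow j
  · rw [zpow_neg, zpow_natCast, neg_smul, natCast_zsmul]
    refine left_inv_eq_right_inv (a := exp (j • a)) ?_ ?_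
    · rw [← hpow, ← map_mul, inv_mul_cancel, map_one]
    · rw [← exp_add_of_commute (Commute.refl _).neg_right, add_neg_cancel, exp_zero]

variable [FiniteDimensional ℝ 𝔸] {h : Submodule ℝ 𝔸} {ρ : G →* 𝔸}

/- Cartan's argument: if `exp c` lies in the group for arbitrarily small `c ≠ 0` in `p`, then so do
all integer powers, which are dense in the one-parameter group of a limiting direction of the `c`;
that direction then lies in both `p` and `h`. -/
theorem IsLieAlgebraOfRange.eventually_eq_zero_of_exp_mem_range (hh : IsLieAlgebraOfRange h ρ)
    (hcl : IsClosed (Set.range ρ)) {p : Submodule ℝ 𝔸} (hp : Disjoint h p) :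
    ∀ᶠ c in 𝓝 (0 : 𝔸), c ∈ p → exp c ∈ Set.range ρ → c = 0 := by
  let _ : NormedAlgebra ℚ 𝔸 := NormedAlgebra.restrictScalars ℚ ℝ 𝔸
  by_contra hfreq
  obtain ⟨c, hc0, hc⟩ := exists_seq_forall_of_frequently (not_eventually.1 hfreq)
  push Not at hc
  have hunit (j : ℕ) : ‖c j‖⁻¹ • c j ∈ sphere (0 : 𝔸) 1 := by
    simp [norm_smul, norm_ne_zero_iff.2 (hc j).2.2]
  obtain ⟨u, hu, φ, hφ, hlim⟩ := (isCompact_sphere (0 : 𝔸) 1).tendsto_subseq hunit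
  have hup : u ∈ p := (Submodule.closed_of_finiteDimensional p).mem_of_tendsto hlim
    (.of_forall fun j => p.smul_mem _ (hc (φ j)).1)
  have huh : u ∈ h := (hh u).2 fun t => by
    have hmul := tendsto_floor_div_norm_zsmul (hc0.comp hφ.tendsto_atTop)
      (fun j => (hc (φ j)).2.2) hlim t
    refine hcl.mem_of_tendsto ((exp_continuous.tendsto _).comp hmul) (.of_forall fun j => ?_)
    obtain ⟨g, hg⟩ := (hc (φ j)).2.1
    exact ⟨g ^ _, map_zpow_eq_exp_zsmul hg _⟩
  exact ne_zero_of_mem_unit_sphere ⟨u, hu⟩ (Submodule.disjoint_def.1 hp u huh hup)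

/- For `f = id` this is Cartan's closed subgroup theorem: near `1`, a closed group consists of
exponentials of elements of its Lie algebra. -/
theorem IsLieAlgebraOfRange.eventually_exists_eq_exp_mul_exp (hh : IsLieAlgebraOfRange h ρ)
    (hcl : IsClosed (Set.range ρ)) (f : h →ₗ[ℝ] h) :
    ∀ᶠ u in 𝓝 (1 : 𝔸), u ∈ Set.range ρ → ∃ a : h, u = exp (f a : 𝔸) * exp (a - f a : 𝔸) := by
  obtain ⟨π, hπ⟩ : ∃ π : 𝔸 →ₗ[ℝ] h, ∀ a : h, π a = a :=
    (h.subtype.exists_leftInverse_of_injective h.ker_subtype).imp fun _ => LinearMap.congr_fun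
  have hdisj : Disjoint h π.ker := Submodule.disjoint_def.2 fun a ha hker =>
    congrArg Subtype.val ((hπ ⟨a, ha⟩).symm.trans hker)
  let f₁ : 𝔸 →L[ℝ] 𝔸 := (h.subtype ∘ₗ f ∘ₗ π).toContinuousLinearMap
  let f₂ : 𝔸 →L[ℝ] 𝔸 := (h.subtype ∘ₗ π).toContinuousLinearMap - f₁
  let f₃ : 𝔸 →L[ℝ] 𝔸 := .id ℝ 𝔸 - (h.subtype ∘ₗ π).toContinuousLinearMap
  have hsum : (f₁ + f₂ + f₃).range = ⊤ := by
    have : f₁ + f₂ + f₃ = .id ℝ 𝔸 := by simp [f₂, f₃]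
    rw [this]
    exact LinearMap.range_id
  have hisolated := (f₃.continuous.tendsto' 0 0 (map_zero f₃)).eventually
    (hh.eventually_eq_zero_of_exp_mem_range hcl hdisj)
  rw [← map_exp_mul_exp_mul_exp_nhds_zero hsum, eventually_map]
  filter_upwards [hisolated] with a ha
  rintro ⟨g, hg⟩
  obtain ⟨g₁, hg₁⟩ := hh.exp_mem_range (a := f₁ a) (f (π a)).2
  obtain ⟨g₂, hg₂⟩ := hh.exp_mem_range (a := f₂ a) (π a - f (π a)).2
  have hker : f₃ a ∈ π.ker := by simp [f₃, LinearMap.mem_ker, hπ]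
  have hexp : ρ ((g₁ * g₂)⁻¹ * g) = exp (f₃ a) := by
    rw [map_mul, hg, ← hg₁, ← hg₂, ← map_mul, ← mul_assoc, ← map_mul, inv_mul_cancel, map_one,
      one_mul]
  refine ⟨π a, ?_⟩
  rw [ha hker ⟨_, hexp⟩, exp_zero, mul_one]
  rfl

end ClosedSubgroup

section Orbit

variable {V : Type*} [NormedAddCommGroup V] [NormedSpace ℝ V] {G : Type*} [Group G]

/-- The subspace `{A x : A ∈ h}`. When `h` is the Lie algebra of a group, it is the tangent space at
`x` of the orbit of `x`. -/
noncomputable def tangentAt (h : Submodule ℝ (V →L[ℝ] V)) (x : V) : Submodule ℝ V :=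
  h.map (ContinuousLinearMap.apply ℝ V x).toLinearMap

theorem range_apply_comp_subtypeL (h : Submodule ℝ (V →L[ℝ] V)) (x : V) :
    (ContinuousLinearMap.apply ℝ V x ∘L h.subtypeL).range = tangentAt h x :=
  (LinearMap.range_comp _ _).trans (congrArg (Submodule.map _) h.range_subtype)

/-- The orbit of a vector under a group acting through linear endomorphisms. -/
def orbit (ρ : G →* V →L[ℝ] V) (x : V) : Set V :=
  Set.range fun g => ρ g x

theorem map_inv_apply_map_apply (ρ : G →* V →L[ℝ] V) (g : G) (x : V) : ρ g⁻¹ (ρ g x) = x := by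
  rw [← mul_apply_eq_comp, ← map_mul, inv_mul_cancel, map_one, one_apply_eq_self]

theorem exp_apply_of_apply_eq_zero [CompleteSpace V] {B : V →L[ℝ] V} {x : V} (hB : B x = 0) :
    exp B x = x := by
  have hterm : ∀ j ≠ 0, ((j.factorial : ℝ)⁻¹ • B ^ j) x = 0 := fun j hj => by
    obtain ⟨i, rfl⟩ := Nat.exists_eq_succ_of_ne_zero hj
    simp [pow_succ, hB]
  have hsum := (exp_series_hasSum_exp' (𝕂 := ℝ) B).mapL (ContinuousLinearMap.apply ℝ V x)
  exact hsum.unique (by simpa using hasSum_single 0 hterm)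

theorem map_smul_exp_apply_nhds [CompleteSpace V] {E : Type*} [NormedAddCommGroup E]
    [NormedSpace ℝ E] [CompleteSpace E] {f : E →L[ℝ] V →L[ℝ] V} {x : V}
    (hspan : Submodule.span ℝ {x} ⊔ (.apply ℝ V x ∘L f).range = ⊤) :
    map (fun z : ℝ × E => z.1 • exp (f z.2) x) (𝓝 (1, 0)) = 𝓝 x := by
  let f' : ℝ × E →L[ℝ] V →L[ℝ] V := f ∘L .snd ℝ ℝ E
  have hexp : HasStrictFDerivAt (fun z => exp (f' z)) f' (1, 0) :=
    hasStrictFDerivAt_exp_comp_of_map_eq_zero f' (map_zero f)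
  have hcurve : HasStrictFDerivAt (fun z : ℝ × E => exp (f z.2) x) (.apply ℝ V x ∘L f') (1, 0) :=
    (ContinuousLinearMap.apply ℝ V x).hasStrictFDerivAt.comp ((1, 0) : ℝ × E) hexp
  have hderiv := (hasStrictFDerivAt_fst (𝕜 := ℝ) (p := ((1, 0) : ℝ × E))).smul hcurve
  have hsurj : map (fun z : ℝ × E => z.1 • exp (f z.2) x) (𝓝 (1, 0)) =
      𝓝 ((1 : ℝ) • exp (f 0) x) := hderiv.map_nhds_eq_of_surj (by
    rw [eq_top_iff, ← hspan]
    intro v hv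
    obtain ⟨_, hw, _, ⟨a, rfl⟩, rfl⟩ := Submodule.mem_sup.1 hv
    obtain ⟨s, rfl⟩ := Submodule.mem_span_singleton.1 hw
    exact ⟨(s, a), by simp [f', add_comm]⟩)
  simpa using hsurj

variable [FiniteDimensional ℝ V] {h : Submodule ℝ (V →L[ℝ] V)} {ρ : G →* V →L[ℝ] V}

theorem IsLieAlgebraOfRange.exists_eventually_apply_eq_exp_apply (hh : IsLieAlgebraOfRange h ρ)
    (hcl : IsClosed (Set.range ρ)) (x : V) :
    ∃ σ : tangentAt h x →ₗ[ℝ] V →L[ℝ] V,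
      ∀ᶠ u in 𝓝 (1 : V →L[ℝ] V), u ∈ Set.range ρ → ∃ w, u x = exp (σ w) x := by
  let ev : h →ₗ[ℝ] tangentAt h x :=
    (ContinuousLinearMap.apply ℝ V x).toLinearMap.submoduleMap h
  obtain ⟨σ, hσ⟩ := ev.exists_rightInverse_of_surjective
    (LinearMap.range_eq_top.2 (LinearMap.submoduleMap_surjective _ h))
  refine ⟨h.subtype ∘ₗ σ, ?_⟩
  filter_upwards [hh.eventually_exists_eq_exp_mul_exp hcl (σ ∘ₗ ev)] with u hu hmem
  obtain ⟨A, rfl⟩ := hu hmem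
  have hfix : (A - σ (ev A) : V →L[ℝ] V) x = 0 :=
    sub_eq_zero.2 (congrArg Subtype.val (LinearMap.congr_fun hσ (ev A))).symm
  exact ⟨ev A, congrArg _ (exp_apply_of_apply_eq_zero hfix)⟩

theorem IsLieAlgebraOfRange.dimH_orbit_le (hh : IsLieAlgebraOfRange h ρ)
    (hcl : IsClosed (Set.range ρ)) (x : V) :
    dimH (orbit ρ x) ≤ finrank ℝ (tangentAt h x) := by
  obtain ⟨σ, hσ⟩ := hh.exists_eventually_apply_eq_exp_apply hcl x
  let chart (u : V →L[ℝ] V) (w : tangentAt h x) : V := u (exp (σ w) x)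
  have hchart : ∀ u ∈ Set.range ρ, {v | v x ∈ Set.range (chart u)} ∈ 𝓝[Set.range ρ] u := by
    rintro _ ⟨g, rfl⟩
    have hshift : Tendsto (fun v => ρ g⁻¹ * v) (𝓝 (ρ g)) (𝓝 1) :=
      (continuous_const_mul (ρ g⁻¹)).tendsto' _ _ (by rw [← map_mul, inv_mul_cancel, map_one])
    rw [mem_nhdsWithin_iff_eventually]
    filter_upwards [hshift.eventually hσ] with v hv
    rintro ⟨k, rfl⟩
    obtain ⟨w, hw⟩ := hv ⟨g⁻¹ * k, map_mul ρ _ _⟩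
    refine ⟨w, ?_⟩
    simpa [chart, ← hw] using map_inv_apply_map_apply ρ g⁻¹ (ρ k x)
  obtain ⟨D, -, hD, hcover⟩ := countable_cover_nhdsWithin_of_sigmaCompact hcl hchart
  have horbit : orbit ρ x ⊆ ⋃ u ∈ D, Set.range (chart u) := by
    rintro _ ⟨g, rfl⟩
    simpa using hcover ⟨g, rfl⟩
  have hsmooth (u : V →L[ℝ] V) : ContDiff ℝ 1 (chart u) := by
    have hexp : ContDiff ℝ 1 (exp : (V →L[ℝ] V) → V →L[ℝ] V) :=
      contDiff_iff_contDiffAt.2 fun A => (exp_analytic (𝕂 := ℝ) A).contDiffAt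
    exact u.contDiff.comp
      ((hexp.comp σ.toContinuousLinearMap.contDiff).clm_apply contDiff_const)
  calc dimH (orbit ρ x) ≤ dimH (⋃ u ∈ D, Set.range (chart u)) := dimH_mono horbit
    _ = ⨆ u ∈ D, dimH (Set.range (chart u)) := dimH_bUnion hD _
    _ ≤ finrank ℝ (tangentAt h x) := iSup₂_le fun u _ => (hsmooth u).dimH_range_le

theorem IsLieAlgebraOfRange.orbit_mem_nhdsWithin_sphere (hh : IsLieAlgebraOfRange h ρ)
    (hρ : ∀ g v, ‖ρ g v‖ = ‖v‖) {x : V} (hx : x ∈ sphere (0 : V) 1)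
    (hspan : Submodule.span ℝ {x} ⊔ tangentAt h x = ⊤) : orbit ρ x ∈ 𝓝[sphere 0 1] x := by
  have hnhds : map (fun z : ℝ × h => z.1 • exp (z.2 : V →L[ℝ] V) x) (𝓝 (1, 0)) = 𝓝 x :=
    map_smul_exp_apply_nhds (E := h) (f := h.subtypeL) (by rwa [range_apply_comp_subtypeL])
  rw [mem_nhdsWithin_iff_eventually, ← hnhds, eventually_map]
  filter_upwards [(continuous_fst.tendsto ((1, 0) : ℝ × h)).eventually (lt_mem_nhds one_pos)]
    with ⟨s, A⟩ hs hsphere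
  obtain ⟨g, hg⟩ := hh.exp_mem_range A.2
  have hs1 : s = 1 := by
    simpa [norm_smul, ← hg, hρ, mem_sphere_zero_iff_norm.1 hx, abs_of_pos hs] using hsphere
  exact ⟨g, by simp [hs1, hg]⟩

theorem isClosed_orbit (hρ : ∀ g v, ‖ρ g v‖ = ‖v‖) (hcl : IsClosed (Set.range ρ)) (x : V) :
    IsClosed (orbit ρ x) := by
  have hbdd : Set.range ρ ⊆ closedBall 0 1 := by
    rintro _ ⟨g, rfl⟩
    exact mem_closedBall_zero_iff.2 <|
      ContinuousLinearMap.opNorm_le_bound _ zero_le_one fun v => by rw [hρ, one_mul]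
  have hcompact := ((isCompact_closedBall _ _).of_isClosed_subset hcl hbdd).image
    (ContinuousLinearMap.apply ℝ V x).continuous
  rw [← Set.range_comp] at hcompact
  exact hcompact.isClosed

end Orbit

section Sphere

variable {V : Type*} [NormedAddCommGroup V] [InnerProductSpace ℝ V]
  {G : Type*} [Group G] {h : Submodule ℝ (V →L[ℝ] V)} {ρ : G →* V →L[ℝ] V}

theorem finrank_le_dimH_sphere {K : Submodule ℝ V} [FiniteDimensional ℝ K] {v : V}
    (hv : ‖v‖ = 1) (hvK : v ∈ Kᗮ) : finrank ℝ K ≤ dimH (sphere (0 : V) 1) := by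
  have hball : ball (0 : K) 1 ⊆ K.orthogonalProjectionOnto '' sphere 0 1 := fun w hw => by
    have hw1 : ‖w‖ ^ 2 ≤ 1 := by
      rw [mem_ball_zero_iff] at hw
      nlinarith [norm_nonneg w]
    refine ⟨w + √(1 - ‖w‖ ^ 2) • v, ?_, ?_⟩
    · have hinner : inner ℝ (w : V) (√(1 - ‖w‖ ^ 2) • v) = 0 := by
        rw [inner_smul_right, K.inner_right_of_mem_orthogonal w.2 hvK, mul_zero]
      have hnorm : ‖(w : V) + √(1 - ‖w‖ ^ 2) • v‖ ^ 2 = 1 := by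
        rw [sq, norm_add_sq_eq_norm_sq_add_norm_sq_real hinner, ← sq, ← sq, norm_smul, hv, mul_one,
          Real.norm_eq_abs, sq_abs, Real.sq_sqrt (sub_nonneg.2 hw1), Submodule.coe_norm]
        ring
      exact mem_sphere_zero_iff_norm.2 <|
        (pow_eq_one_iff_of_nonneg (norm_nonneg _) two_ne_zero).1 hnorm
    · simp [hvK]
  calc (finrank ℝ K : ENNReal) = dimH (ball (0 : K) 1) :=
        (Real.dimH_of_mem_nhds (ball_mem_nhds 0 one_pos)).symm
    _ ≤ dimH (K.orthogonalProjectionOnto '' sphere 0 1) := dimH_mono hball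
    _ ≤ dimH (sphere (0 : V) 1) := dimH_orthogonalProjectionOnto_le K _

theorem IsLieAlgebraOfRange.inner_self_apply_eq_zero [CompleteSpace V]
    (hh : IsLieAlgebraOfRange h ρ) (hρ : ∀ g v, ‖ρ g v‖ = ‖v‖) {A : V →L[ℝ] V} (hA : A ∈ h)
    (x : V) : inner ℝ x (A x) = 0 := by
  have hflow : HasDerivAt (fun t : ℝ => exp (t • A) x) (A x) 0 := by
    simpa using (hasDerivAt_exp_smul_const A (0 : ℝ)).clm_apply (hasDerivAt_const 0 x)
  have hconst : (fun t : ℝ => ‖exp (t • A) x‖ ^ 2) = fun _ => ‖x‖ ^ 2 := funext fun t => by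
    obtain ⟨g, hg⟩ := (hh A).1 hA t
    rw [← hg, hρ]
  have hderiv : HasDerivAt (fun t : ℝ => ‖exp (t • A) x‖ ^ 2) (2 * inner ℝ x (A x)) 0 := by
    simpa using hflow.norm_sq
  have hzero : 2 * inner ℝ x (A x) = 0 :=
    hderiv.unique (hconst ▸ hasDerivAt_const 0 (‖x‖ ^ 2))
  exact (mul_eq_zero.1 hzero).resolve_left two_ne_zero

theorem IsLieAlgebraOfRange.tangentAt_le_orthogonal [CompleteSpace V] (hh : IsLieAlgebraOfRange h ρ)
    (hρ : ∀ g v, ‖ρ g v‖ = ‖v‖) (x : V) : tangentAt h x ≤ (Submodule.span ℝ {x})ᗮ := by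
  rintro _ ⟨A, hA, rfl⟩
  exact Submodule.mem_orthogonal_singleton_iff_inner_right.2 (hh.inner_self_apply_eq_zero hρ hA x)

variable [FiniteDimensional ℝ V]

theorem finrank_orthogonal_span_singleton_eq_sub_one {x : V} (hx : x ≠ 0) :
    finrank ℝ (Submodule.span ℝ {x})ᗮ = finrank ℝ V - 1 := by
  have hadd := (Submodule.span ℝ {x}).finrank_add_finrank_orthogonal
  rw [finrank_span_singleton hx] at hadd
  omega

theorem IsLieAlgebraOfRange.finrank_tangentAt_of_sphere_subset_orbit
    (hh : IsLieAlgebraOfRange h ρ) (hρ : ∀ g v, ‖ρ g v‖ = ‖v‖) (hcl : IsClosed (Set.range ρ))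
    {x : V} (hx : x ∈ sphere (0 : V) 1) (horbit : sphere 0 1 ⊆ orbit ρ x) :
    finrank ℝ (tangentAt h x) = finrank ℝ V - 1 := by
  rw [← finrank_orthogonal_span_singleton_eq_sub_one (ne_zero_of_mem_unit_sphere ⟨x, hx⟩)]
  refine le_antisymm (Submodule.finrank_mono (hh.tangentAt_le_orthogonal hρ x)) ?_
  have hxK : x ∈ (Submodule.span ℝ {x})ᗮᗮ :=
    Submodule.le_orthogonal_orthogonal _ (Submodule.mem_span_singleton_self x)
  exact_mod_cast calc
    (finrank ℝ (Submodule.span ℝ {x})ᗮ : ENNReal) ≤ dimH (sphere (0 : V) 1) :=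
        finrank_le_dimH_sphere (mem_sphere_zero_iff_norm.1 hx) hxK
    _ ≤ dimH (orbit ρ x) := dimH_mono horbit
    _ ≤ finrank ℝ (tangentAt h x) := hh.dimH_orbit_le hcl x

theorem IsLieAlgebraOfRange.span_sup_tangentAt_eq_top (hh : IsLieAlgebraOfRange h ρ)
    (hρ : ∀ g v, ‖ρ g v‖ = ‖v‖) {x : V} (hx : x ≠ 0)
    (hrank : finrank ℝ (tangentAt h x) = finrank ℝ V - 1) :
    Submodule.span ℝ {x} ⊔ tangentAt h x = ⊤ := by
  rw [← finrank_orthogonal_span_singleton_eq_sub_one hx] at hrank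
  rw [Submodule.eq_of_le_of_finrank_eq (hh.tangentAt_le_orthogonal hρ x) hrank]
  exact Submodule.sup_orthogonal_of_hasOrthogonalProjection

theorem sphere_subset_orbit_of_mem_nhdsWithin (hV : 2 ≤ finrank ℝ V)
    (hρ : ∀ g v, ‖ρ g v‖ = ‖v‖) (hcl : IsClosed (Set.range ρ)) {x : V}
    (hx : x ∈ sphere (0 : V) 1) (hnhds : orbit ρ x ∈ 𝓝[sphere 0 1] x) :
    sphere 0 1 ⊆ orbit ρ x := by
  have hopen : ∀ y ∈ orbit ρ x, orbit ρ x ∈ 𝓝[sphere 0 1] y := by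
    rintro _ ⟨g, rfl⟩
    have hback : Tendsto (ρ g⁻¹) (𝓝[sphere 0 1] (ρ g x)) (𝓝[sphere 0 1] x) := by
      refine ((ρ g⁻¹).continuous.tendsto' _ _ (map_inv_apply_map_apply ρ g x)).inf ?_
      exact tendsto_principal_principal.2 fun y hy => by simpa [hρ] using hy
    filter_upwards [hback hnhds] with y hy
    obtain ⟨k, hk⟩ := hy
    refine ⟨g * k, ?_⟩
    simpa [← hk] using map_inv_apply_map_apply ρ g⁻¹ y
  have : PreconnectedSpace (sphere (0 : V) 1) := Subtype.preconnectedSpace <|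
    isPreconnected_sphere (by rw [← finrank_eq_rank]; exact_mod_cast hV) 0 1
  have hclopen : IsClopen ((↑) ⁻¹' orbit ρ x : Set (sphere (0 : V) 1)) :=
    ⟨(isClosed_orbit hρ hcl x).preimage continuous_subtype_val, isOpen_iff_mem_nhds.2
      fun y hy => preimage_coe_mem_nhds_subtype.2 (hopen y hy)⟩
  have huniv := hclopen.eq_univ ⟨⟨x, hx⟩, 1, by simp⟩
  exact fun y hy => huniv.ge (Set.mem_univ ⟨y, hy⟩)

end Sphere

end SphereAction

open Metric Module SphereAction in
theorem mainTheorem7_general {V : Type*} [NormedAddCommGroup V] [InnerProductSpace ℝ V]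
    [FiniteDimensional ℝ V] (hV : 2 ≤ finrank ℝ V) {G : Type*} [Group G] {ρ : G →* V →L[ℝ] V}
    (hρ : ∀ g v, ‖ρ g v‖ = ‖v‖) (hcl : IsClosed (Set.range ρ)) {h : Submodule ℝ (V →L[ℝ] V)}
    (hh : IsLieAlgebraOfRange h ρ) :
    (∀ x ∈ sphere (0 : V) 1, ∀ y ∈ sphere (0 : V) 1, ∃ g, ρ g x = y) ↔
      ∃ x ∈ sphere (0 : V) 1, finrank ℝ (tangentAt h x) = finrank ℝ V - 1 := by
  constructor
  · intro htrans
    have : Nontrivial V := finrank_pos_iff.1 (two_pos.trans_le hV)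
    obtain ⟨x, hx⟩ := NormedSpace.sphere_nonempty (x := (0 : V)).2 zero_le_one
    exact ⟨x, hx, hh.finrank_tangentAt_of_sphere_subset_orbit hρ hcl hx (htrans x hx)⟩
  · rintro ⟨x, hx, hrank⟩ y hy z hz
    have hspan := hh.span_sup_tangentAt_eq_top hρ (ne_zero_of_mem_unit_sphere ⟨x, hx⟩) hrank
    have horbit := sphere_subset_orbit_of_mem_nhdsWithin hV hρ hcl hx
      (hh.orbit_mem_nhdsWithin_sphere hρ hx hspan)
    obtain ⟨k, rfl⟩ := horbit hy
    obtain ⟨g, rfl⟩ := horbit hz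
    exact ⟨g * k⁻¹, by simp [map_inv_apply_map_apply]⟩

namespace SphereAction

open NormedSpace Matrix

variable {n : ℕ}

/-- Matrices as linear endomorphisms of Euclidean space: Mathlib's `Matrix.toEuclideanCLM` together
with its continuity, for the entrywise topology on matrices. -/
noncomputable def matrixEquivCLM (n : ℕ) : Matrix (Fin n) (Fin n) ℝ ≃A[ℝ]
    (EuclideanSpace ℝ (Fin n) →L[ℝ] EuclideanSpace ℝ (Fin n)) where
  toAlgEquiv := (toEuclideanCLM (n := Fin n) (𝕜 := ℝ)).toAlgEquiv
  continuous_toFun := LinearMap.continuous_of_finiteDimensional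
    (toEuclideanCLM (n := Fin n) (𝕜 := ℝ)).toAlgEquiv.toLinearMap
  continuous_invFun := LinearMap.continuous_of_finiteDimensional
    (toEuclideanCLM (n := Fin n) (𝕜 := ℝ)).toAlgEquiv.symm.toLinearMap

/-- The inclusion of a subgroup of `SO(n)` into the linear endomorphisms of Euclidean space; it
carries the matrix action `mulVecE` to the application of linear maps. -/
noncomputable def euclideanRep (H : Subgroup (SO n)) :
    H →* EuclideanSpace ℝ (Fin n) →L[ℝ] EuclideanSpace ℝ (Fin n) :=
  (matrixEquivCLM n : _ →* _).comp
    ((specialOrthogonalGroup (Fin n) ℝ).subtype.comp H.subtype)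

/-- The Lie algebra `h`, acting on Euclidean space. -/
noncomputable def euclideanLieAlgebra (h : LieSubalgebra ℝ (Matrix (Fin n) (Fin n) ℝ)) :
    Submodule ℝ (EuclideanSpace ℝ (Fin n) →L[ℝ] EuclideanSpace ℝ (Fin n)) :=
  h.toSubmodule.map (matrixEquivCLM n).toAlgEquiv.toLinearMap

theorem norm_euclideanRep_apply (H : Subgroup (SO n)) (g : H) (x : EuclideanSpace ℝ (Fin n)) :
    ‖euclideanRep H g x‖ = ‖x‖ :=
  norm_mulVecE (g : SO n) x

theorem isClosed_specialOrthogonalGroup {m : Type*} [Fintype m] [DecidableEq m] :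
    IsClosed (specialOrthogonalGroup m ℝ : Set (Matrix m m ℝ)) :=
  isClosed_unitary.inter (isClosed_singleton.preimage continuous_id.matrix_det)

theorem isClosed_range_euclideanRep {H : Subgroup (SO n)} (hH : IsClosed (H : Set (SO n))) :
    IsClosed (Set.range (euclideanRep H)) := by
  have himage := isClosed_specialOrthogonalGroup.isClosedEmbedding_subtypeVal.isClosedMap _ hH
  convert! (matrixEquivCLM n).toHomeomorph.isClosedMap _ himage using 1
  ext
  simp [euclideanRep]

open scoped Matrix.Norms.Operator in
theorem matrixEquivCLM_exp (A : Matrix (Fin n) (Fin n) ℝ) :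
    matrixEquivCLM n (exp A) = exp (matrixEquivCLM n A) :=
  map_exp (matrixEquivCLM n) (matrixEquivCLM n).continuous A

theorem IsLieAlgebraOf.isLieAlgebraOfRange {h : LieSubalgebra ℝ (Matrix (Fin n) (Fin n) ℝ)}
    {H : Subgroup (SO n)} (hH : IsLieAlgebraOf h H) :
    IsLieAlgebraOfRange (euclideanLieAlgebra h) (euclideanRep H) := by
  intro B
  obtain ⟨A, rfl⟩ := (matrixEquivCLM n).surjective B
  have hmem : matrixEquivCLM n A ∈ euclideanLieAlgebra h ↔ A ∈ h :=
    Function.Injective.mem_set_image (matrixEquivCLM n).injective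
  rw [hmem, hH A]
  refine forall_congr' fun t => ?_
  rw [← map_smul, ← matrixEquivCLM_exp]
  simp [euclideanRep]

theorem finrank_tangentAt_euclideanLieAlgebra
    (h : LieSubalgebra ℝ (Matrix (Fin n) (Fin n) ℝ)) (x : EuclideanSpace ℝ (Fin n)) :
    Module.finrank ℝ (tangentAt (euclideanLieAlgebra h) x) = rankAt h x :=
  congrArg (fun K : Submodule ℝ (EuclideanSpace ℝ (Fin n)) => Module.finrank ℝ K)
    (Submodule.map_comp _ _ _).symm

theorem isPretransitive_sphere_iff (H : Subgroup (SO n)) :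
    MulAction.IsPretransitive H (Sphere n) ↔
      ∀ x ∈ Metric.sphere (0 : EuclideanSpace ℝ (Fin n)) 1,
        ∀ y ∈ Metric.sphere (0 : EuclideanSpace ℝ (Fin n)) 1, ∃ g, euclideanRep H g x = y where
  mp _ x hx y hy := (MulAction.exists_smul_eq H (⟨x, hx⟩ : Sphere n) ⟨y, hy⟩).imp
    fun _ => congrArg Subtype.val
  mpr htrans := ⟨fun x y => (htrans x x.2 y y.2).imp fun _ => Subtype.ext⟩

end SphereAction

theorem mainTheorem7 (n : ℕ) (hn : 2 ≤ n)
    (h : LieSubalgebra ℝ (Matrix (Fin n) (Fin n) ℝ))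
    (h_so : h ≤ LieAlgebra.Orthogonal.so (Fin n) ℝ)
    (H : Subgroup (SphereAction.SO n))
    (H_closed : IsClosed (H : Set (SphereAction.SO n)))
    (h_H : SphereAction.IsLieAlgebraOf h H) :
    MulAction.IsPretransitive H (SphereAction.Sphere n) ↔
      ∃ x : SphereAction.Sphere n,
        SphereAction.rankAt h (x : EuclideanSpace ℝ (Fin n)) = n - 1 := by
  rw [SphereAction.isPretransitive_sphere_iff, mainTheorem7_general (by simpa)
    (SphereAction.norm_euclideanRep_apply H) (SphereAction.isClosed_range_euclideanRep H_closed)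
    h_H.isLieAlgebraOfRange]
  simp [SphereAction.finrank_tangentAt_euclideanLieAlgebra]
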